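/- Let $\mathcal H=\bigotimes_{i=1}^n\mathcal H_{A_i}$ be a finite-dimensional $n$-partite Hilbert space with Hermitian local Hamiltonians $H_{A_i}$ on $\mathcal H_{A_i}$ and total Hamiltonian $H=\sum_i H_{A_i}\otimes\mathbb I$ (identity on all other factors). For a state $\rho$ and a Hamiltonian $K$ on the same space put $$\mathcal C(\rho;K)=\max_U W_U(\rho;K)-\min_U W_U(\rho;K),\qquad W_U(\rho;K)=\mathrm{Tr}[\rho K]-\mathrm{Tr}[U\rho U^\dagger K],$$ with $U$ ranging over all unitaries (the battery capacity: ergotropy minus antiergotropy), and let $$\Delta(\rho)=\Delta_{A_1|\cdots|A_n}(\rho;H)=\mathcal C(\rho;H)-\sum_{i=1}^n\mathcal C(\rho_{A_i};H_{A_i}),$$ where $\rho_{A_i}$ is the reduced state of party $i$. An LOCC protocol consists of finitely many rounds; in each round one party performs a measurement (finitely many outcomes, given by Kraus operators) on its own system and broadcasts the outcome, and then the other parties apply local isometries that may depend on it; everything that follows may depend on all earlier outcomes, local dimensions may change on the way, and the final local spaces are again the $\mathcal H_{A_i}$. Each complete sequence $b$ of outcomes has a product Kraus operator $M_b$ on $\mathcal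 H$. Then, for pure states, $\Delta$ does not increase under LOCC: for every unit vector $|\Psi\rangle\in\mathcal H$ and every LOCC protocol $(M_b)_b$, (1) with $p_b=\|M_b\Psi\|^2$ and, for $p_b>0$, $|\Phi_b\rangle=M_b|\Psi\rangle/\sqrt{p_b}$, $$\sum_{b:\,p_b>0} p_b\,\Delta(|\Phi_b\rangle\langle\Phi_b|)\le\Delta(|\Psi\rangle\langle\Psi|);$$ (2) if the protocol transforms $|\Psi\rangle$ deterministically into a pure state $|\Phi\rangle\in\mathcal H$, i.e. $\sum_b M_b|\Psi\rangle\langle\Psi|M_b^\dagger=|\Phi\rangle\langle\Phi|$, then $\Delta(|\Phi\rangle\langle\Phi|)\le\Delta(|\Psi\rangle\langle\Psi|)$. -/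

import Mathlib

namespace Battery

noncomputable section

open Matrix

/-! Finite-dimensional quantum systems. A system with orthonormal basis `κ` has Hilbert space
`EuclideanSpace ℂ κ`; states and observables on it are matrices indexed by `κ`. -/

section Capacity

variable {κ : Type*} [Fintype κ] [DecidableEq κ]

/-- Mean energy extracted from `ρ` by the unitary `U`: `Tr[ρ H] - Tr[U ρ U† H]`. -/
def extractedWork (ρ H : Matrix κ κ ℂ) (U : Matrix.unitaryGroup κ ℂ) : ℝ :=
  (trace (ρ * H) - trace ((U : Matrix κ κ ℂ) * ρ * (U : Matrix κ κ ℂ)ᴴ * H)).re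

/-- The ergotropy: the largest work that a unitary can extract
(the unitary group is compact, so the supremum is a maximum). -/
def ergotropy (ρ H : Matrix κ κ ℂ) : ℝ :=
  ⨆ U : Matrix.unitaryGroup κ ℂ, extractedWork ρ H U

/-- The antiergotropy: the smallest value of the extracted work. -/
def antiergotropy (ρ H : Matrix κ κ ℂ) : ℝ :=
  ⨅ U : Matrix.unitaryGroup κ ℂ, extractedWork ρ H U

/-- The battery capacity `𝒞(ρ; H)`. -/
def capacity (ρ H : Matrix κ κ ℂ) : ℝ :=
  ergotropy ρ H - antiergotropy ρ H

/-- The density matrix `|Ψ⟩⟨Ψ|`. -/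
def pureState (Ψ : EuclideanSpace ℂ κ) : Matrix κ κ ℂ :=
  Matrix.of fun x y => Ψ x * star (Ψ y)

end Capacity

/-! Composite systems. Party `i` has dimension `d i`; the tensor product of the local spaces
has the product basis, indexed by `∀ i, Fin (d i)`. -/

section Composite

variable {n : ℕ}

/-- The tensor product `⨂ i, K i` of local operators. -/
def prodOp {d e : Fin n → ℕ} (K : ∀ i, Matrix (Fin (e i)) (Fin (d i)) ℂ) :
    Matrix (∀ i, Fin (e i)) (∀ i, Fin (d i)) ℂ :=
  Matrix.of fun x y => ∏ i, K i (x i) (y i)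

variable {d : Fin n → ℕ}

/-- The operator that acts as `A` on party `i` and as the identity on all other parties. -/
def localOp (i : Fin n) (A : Matrix (Fin (d i)) (Fin (d i)) ℂ) :
    Matrix (∀ i, Fin (d i)) (∀ i, Fin (d i)) ℂ :=
  prodOp (Function.update (fun j => (1 : Matrix (Fin (d j)) (Fin (d j)) ℂ)) i A)

/-- The interaction-free Hamiltonian `∑ i, H i ⊗ 𝕀`. -/
def totalHamiltonian (H : ∀ i, Matrix (Fin (d i)) (Fin (d i)) ℂ) :
    Matrix (∀ i, Fin (d i)) (∀ i, Fin (d i)) ℂ :=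
  ∑ i, localOp i (H i)

/-- The reduced state of party `i`: the partial trace over all other parties. The sum runs over
the basis labels `x` of the whole system whose `i`-th entry is `a`, i.e. over the labels of the
other parties; the column label agrees with `x` except for the `i`-th entry `b`. -/
def reducedState (i : Fin n) (ρ : Matrix (∀ i, Fin (d i)) (∀ i, Fin (d i)) ℂ) :
    Matrix (Fin (d i)) (Fin (d i)) ℂ :=
  Matrix.of fun a b =>
    ∑ x ∈ Finset.univ.filter (fun x : ∀ i, Fin (d i) => x i = a), ρ x (Function.update x i b)

/-- The fully separable battery capacity gap `Δ_{A₁|⋯|Aₙ}(ρ; H)`. -/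
def capacityGap (H : ∀ i, Matrix (Fin (d i)) (Fin (d i)) ℂ)
    (ρ : Matrix (∀ i, Fin (d i)) (∀ i, Fin (d i)) ℂ) : ℝ :=
  capacity ρ (totalHamiltonian H) - ∑ i, capacity (reducedState i ρ) (H i)

end Composite

/-! Local operations and classical communication. -/

section LOCC

variable {n : ℕ}

/-- An LOCC protocol among `n` parties that leads from local dimensions `d` (the index) to local
dimensions `e` (the parameter), as a finite tree. Either nothing is left to be done, or some
party `a` performs a measurement on its own system, with finitely many outcomes `k` and Kraus
operators `K k a`, and broadcasts the outcome; conditioned on it, each other party `j` applies a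
local isometry `K k j` (for instance the identity), and a protocol that may depend on the outcome
follows. Local dimensions may change on the way (`f k` after outcome `k`), so ancillas may be
attached and discarded. General local channels and instruments arise by ignoring outcomes. -/
inductive LOCCProtocol (e : Fin n → ℕ) : (Fin n → ℕ) → Type
  | done : LOCCProtocol e e
  | round {d : Fin n → ℕ} (a : Fin n) (m : ℕ) (f : Fin m → Fin n → ℕ)
      (K : ∀ (k : Fin m) (j : Fin n), Matrix (Fin (f k j)) (Fin (d j)) ℂ)
      (measurement : ∑ k, (K k a)ᴴ * K k a = 1)
      (isometries : ∀ k j, j ≠ a → (K k j)ᴴ * K k j = 1)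
      (next : ∀ k, LOCCProtocol e (f k)) : LOCCProtocol e d

/-- The global Kraus operators of a protocol, one for each complete sequence of outcomes. -/
def LOCCProtocol.krausOps {e : Fin n → ℕ} : ∀ {d : Fin n → ℕ}, LOCCProtocol e d →
    List (Matrix (∀ i, Fin (e i)) (∀ i, Fin (d i)) ℂ)
  | _, .done => [1]
  | _, .round _ m _ K _ _ next =>
      (List.finRange m).flatMap fun k => (next k).krausOps.map fun M => M * prodOp (K k)

/-- The channel that a protocol implements when all outcomes are ignored at the end. -/
def LOCCProtocol.channel {d e : Fin n → ℕ} (P : LOCCProtocol e d)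
    (ρ : Matrix (∀ i, Fin (d i)) (∀ i, Fin (d i)) ℂ) :
    Matrix (∀ i, Fin (e i)) (∀ i, Fin (e i)) ℂ :=
  (P.krausOps.map fun M => M * ρ * Mᴴ).sum

variable {κ κ' : Type*} [Fintype κ] [Fintype κ']

/-- The probability `Tr[M ρ M†]` of the outcome with Kraus operator `M`. -/
def outcomeProb (M : Matrix κ' κ ℂ) (ρ : Matrix κ κ ℂ) : ℝ :=
  (trace (M * ρ * Mᴴ)).re

/-- The state `M ρ M† / Tr[M ρ M†]` after the outcome with Kraus operator `M`
(irrelevant if the outcome has probability zero). -/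
def postState (M : Matrix κ' κ ℂ) (ρ : Matrix κ κ ℂ) : Matrix κ' κ' ℂ :=
  (((outcomeProb M ρ)⁻¹ : ℝ) : ℂ) • (M * ρ * Mᴴ)

end LOCC

end

end Battery

namespace Battery

open Matrix
open scoped ComplexOrder

/-! ### Spectral shifts, polar decomposition and singular values. -/

section Spectral

variable {ι κ μ : Type*} [Fintype ι] [Fintype κ] [Fintype μ]

/-! For a pure state the total capacity is the spectral width of the total Hamiltonian times the
squared norm, and the squared norm is conserved on average. The claim thus reduces to showing that
the local capacities of the reduced states do not decrease on average in any single round.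

Up to a multiple of the trace, a local capacity is a sum of two values of `maxOverlap A ρ`, the
maximum of `Re Tr[K ρ K† A]` over contractions `K`, for positive shifts `A` of `H` and `-H`
(`capacity_eq_maxOverlap`). Contractions give the same maximum as unitaries
(`iSup_unitary_overlap`), but they also make sense between different spaces, so intermediate local
dimensions cause no trouble.

Write the vector as a matrix `X` for the split `i | rest`; the reduced state is `X X†`. Since
`maxOverlap` is subadditive in the state and takes equal values on `X X†` and `X† X`, both kinds of
round are covered (`maxOverlap_reducedState_le_sum`). If party `i` measures, `X† X` is the sum of
the corresponding operators after the outcomes. If another party measures, `X X†` itself splits into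
the reduced states, up to an isometry on `i`.

For a deterministic transformation, each `M_b Ψ` is a multiple of `Φ`, so the average is the gap of
`Φ`. -/

theorem exists_unitary_diagonalization [DecidableEq κ] {G : Matrix κ κ ℂ} (hG : G.IsHermitian) :
    ∃ V : Matrix κ κ ℂ, Vᴴ * V = 1 ∧ V * Vᴴ = 1 ∧
      G = V * diagonal (fun i => (hG.eigenvalues i : ℂ)) * Vᴴ := by
  refine ⟨hG.eigenvectorUnitary, ?_, ?_, ?_⟩
  · exact (Matrix.mem_unitaryGroup_iff').1 hG.eigenvectorUnitary.2
  · exact (Matrix.mem_unitaryGroup_iff).1 hG.eigenvectorUnitary.2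
  · conv_lhs => rw [hG.spectral_theorem]
    rfl

theorem exists_add_smul_posSemidef [DecidableEq κ] {G : Matrix κ κ ℂ} (hG : G.IsHermitian) :
    ∃ c : ℝ, (G + (c : ℂ) • 1).PosSemidef := by
  obtain ⟨V, -, hV, h⟩ := exists_unitary_diagonalization hG
  refine ⟨∑ i, |hG.eigenvalues i|, ?_⟩
  set c : ℝ := ∑ i, |hG.eigenvalues i| with hc
  have hd : (diagonal fun i => ((hG.eigenvalues i + c : ℝ) : ℂ)).PosSemidef := by
    refine PosSemidef.diagonal fun i => ?_
    have h1 : |hG.eigenvalues i| ≤ c :=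
      Finset.single_le_sum (f := fun i => |hG.eigenvalues i|) (fun _ _ => abs_nonneg _)
        (Finset.mem_univ i)
    have h2 := neg_abs_le (hG.eigenvalues i)
    simp only [Pi.zero_apply]
    exact_mod_cast (by linarith : 0 ≤ hG.eigenvalues i + c)
  have key : G + (c : ℂ) • 1 =
      V * (diagonal fun i => ((hG.eigenvalues i + c : ℝ) : ℂ)) * Vᴴ := by
    have : (diagonal fun i => ((hG.eigenvalues i + c : ℝ) : ℂ)) =
        diagonal (fun i => (hG.eigenvalues i : ℂ)) + (c : ℂ) • (1 : Matrix κ κ ℂ) := by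
      ext i j
      by_cases hij : i = j <;> simp [diagonal, hij]
    rw [this, Matrix.mul_add, Matrix.add_mul, ← h]
    simp [hV]
  rw [key]
  exact hd.mul_mul_conjTranspose_same V

theorem posSemidef_one_sub_of_projection [DecidableEq κ] {Q : Matrix κ κ ℂ} (hQ : Qᴴ = Q)
    (hQQ : Q * Q = Q) : (1 - Q).PosSemidef := by
  have : 1 - Q = (1 - Q)ᴴ * (1 - Q) := by
    simp [Matrix.sub_mul, Matrix.mul_sub, hQ, hQQ]
  rw [this]
  exact posSemidef_conjTranspose_mul_self _

/-- A consequence of the polar decomposition: `X` and `Xᴴ` are intertwined by a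
partial isometry. -/
theorem exists_eq_mul_conjTranspose_mul [DecidableEq ι] [DecidableEq κ] (X : Matrix ι κ ℂ) :
    ∃ W : Matrix ι κ ℂ, (1 - Wᴴ * W).PosSemidef ∧ (1 - W * Wᴴ).PosSemidef ∧ X = W * Xᴴ * W := by
  have hX : (Xᴴ * X).PosSemidef := posSemidef_conjTranspose_mul_self X
  obtain ⟨V, hV, hV', hG⟩ := exists_unitary_diagonalization hX.1
  set l := hX.1.eigenvalues with hl
  have hl0 : ∀ i, 0 ≤ l i := hX.eigenvalues_nonneg
  set D : Matrix κ κ ℂ := diagonal (fun i => (l i : ℂ)) with hD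
  -- Since `0⁻¹ = 0`, `V s V†` is the pseudo-inverse of `(X† X)^{1/2}`. The witness `W` is `X` times
  -- it, the partial isometry of the polar decomposition.
  set s : Matrix κ κ ℂ := diagonal (fun i => (((√(l i))⁻¹ : ℝ) : ℂ)) with hs
  set P : Matrix κ κ ℂ := diagonal (fun i => if l i = 0 then 0 else 1) with hP
  have sH : sᴴ = s := by
    rw [hs, diagonal_conjTranspose]; congr 1; ext i; simp
  have PH : Pᴴ = P := by
    rw [hP, diagonal_conjTranspose]; congr 1; ext i; by_cases h : l i = 0 <;> simp [h]
  have PP : P * P = P := by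
    rw [hP, diagonal_mul_diagonal]; congr 1; ext i; by_cases h : l i = 0 <;> simp [h]
  have sP : s * P = s := by
    rw [hP, hs, diagonal_mul_diagonal]; congr 1; ext i; by_cases h : l i = 0 <;> simp [h]
  have DP : D * P = D := by
    rw [hP, hD, diagonal_mul_diagonal]; congr 1; ext i; by_cases h : l i = 0 <;> simp [h]
  have sDs : s * D * s = P := by
    rw [hP, hD, hs, diagonal_mul_diagonal, diagonal_mul_diagonal]; congr 1; ext i
    by_cases h : l i = 0
    · simp [h]
    · have h1 : (√(l i))⁻¹ * l i * (√(l i))⁻¹ = 1 := by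
        have h2 : √(l i) ≠ 0 := by
          rw [Real.sqrt_ne_zero (hl0 i)]; exact h
        field_simp
        exact (Real.sq_sqrt (hl0 i)).symm
      simp only [h, if_false]
      exact_mod_cast h1
  have conj : ∀ A B : Matrix κ κ ℂ, (V * A * Vᴴ) * (V * B * Vᴴ) = V * (A * B) * Vᴴ := by
    intro A B
    calc (V * A * Vᴴ) * (V * B * Vᴴ) = V * A * (Vᴴ * V) * B * Vᴴ := by
          simp only [Matrix.mul_assoc]
      _ = _ := by rw [hV]; simp only [Matrix.mul_assoc, Matrix.one_mul]
  set S := V * s * Vᴴ with hS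
  set Q := V * P * Vᴴ with hQ
  have SH : Sᴴ = S := by simp [hS, conjTranspose_mul, sH, Matrix.mul_assoc]
  have QH : Qᴴ = Q := by simp [hQ, conjTranspose_mul, PH, Matrix.mul_assoc]
  have QQ : Q * Q = Q := by rw [hQ, conj, PP]
  have SQ : S * Q = S := by rw [hQ, hS, conj, sP]
  have GQ : Xᴴ * X * Q = Xᴴ * X := by rw [hG, hQ, conj, DP]
  have SGS : S * (Xᴴ * X) * S = Q := by rw [hG, hS, conj, conj, sDs]
  have XQ : X * Q = X := by
    have h0 : (X * (1 - Q))ᴴ * (X * (1 - Q)) = 0 := by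
      have : (X * (1 - Q))ᴴ * (X * (1 - Q)) = (1 - Q)ᴴ * (Xᴴ * X - Xᴴ * X * Q) := by
        rw [conjTranspose_mul, Matrix.mul_assoc, ← Matrix.mul_assoc Xᴴ, Matrix.mul_sub (Xᴴ * X),
          Matrix.mul_one]
      rw [this, GQ, sub_self, Matrix.mul_zero]
    have h1 := conjTranspose_mul_self_eq_zero.1 h0
    rw [Matrix.mul_sub, Matrix.mul_one, sub_eq_zero] at h1
    exact h1.symm
  have WW : (X * S)ᴴ * (X * S) = Q := by
    rw [← SGS, conjTranspose_mul, SH]; simp only [Matrix.mul_assoc]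
  have WQ : X * S * Q = X * S := by rw [Matrix.mul_assoc, SQ]
  refine ⟨X * S, ?_, ?_, ?_⟩
  · rw [WW]; exact posSemidef_one_sub_of_projection QH QQ
  · refine posSemidef_one_sub_of_projection ?_ ?_
    · rw [conjTranspose_mul, conjTranspose_conjTranspose]
    · calc X * S * (X * S)ᴴ * (X * S * (X * S)ᴴ)
          = X * S * ((X * S)ᴴ * (X * S)) * (X * S)ᴴ := by simp only [Matrix.mul_assoc]
        _ = _ := by rw [WW, WQ]
  · calc X = X * Q := XQ.symm
      _ = _ := by rw [← SGS]; simp only [Matrix.mul_assoc]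

/-- With `V` diagonalizing `K† K`, the columns of `K V` are orthogonal. The nonzero ones,
normalized, extend to an orthonormal basis, which gives `B`. -/
theorem exists_singular_value_decomposition [DecidableEq κ] (K : Matrix κ κ ℂ) :
    ∃ (B V : Matrix κ κ ℂ) (s : κ → ℝ), Bᴴ * B = 1 ∧ Vᴴ * V = 1 ∧ V * Vᴴ = 1 ∧ (∀ i, 0 ≤ s i) ∧
      K = B * diagonal (fun i => (s i : ℂ)) * Vᴴ := by
  have hX : (Kᴴ * K).PosSemidef := posSemidef_conjTranspose_mul_self K
  obtain ⟨V, hV, hV', hG⟩ := exists_unitary_diagonalization hX.1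
  set l := hX.1.eigenvalues with hl
  have hl0 : ∀ i, 0 ≤ l i := hX.eigenvalues_nonneg
  have hgram : (K * V)ᴴ * (K * V) = diagonal (fun i => (l i : ℂ)) := by
    calc (K * V)ᴴ * (K * V) = Vᴴ * (Kᴴ * K) * V := by
          rw [conjTranspose_mul]; simp only [Matrix.mul_assoc]
      _ = (Vᴴ * V) * diagonal (fun i => (l i : ℂ)) * (Vᴴ * V) := by
          rw [hG]; simp only [Matrix.mul_assoc]
      _ = _ := by rw [hV, Matrix.one_mul, Matrix.mul_one]
  let c : κ → EuclideanSpace ℂ κ := fun j => WithLp.toLp 2 (fun i => (K * V) i j)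
  have hinner : ∀ i j, inner ℂ (c i) (c j) = if i = j then (l i : ℂ) else 0 := by
    intro i j
    have := congrFun (congrFun hgram i) j
    rw [diagonal_apply] at this
    rw [← this, Matrix.mul_apply, PiLp.inner_apply]
    exact Finset.sum_congr rfl fun x _ => by simp [c, mul_comm]
  let v : κ → EuclideanSpace ℂ κ := fun j => ((√(l j) : ℂ))⁻¹ • c j
  have hsq : ∀ i, (√(l i) : ℂ) * √(l i) = l i := fun i => by
    exact_mod_cast Real.mul_self_sqrt (hl0 i)
  have hv : Orthonormal ℂ (({i | l i ≠ 0} : Set κ).domRestrict v) := by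
    rw [orthonormal_iff_ite]
    rintro ⟨i, hi⟩ ⟨j, hj⟩
    simp only [Set.domRestrict_apply, v, inner_smul_left, inner_smul_right, hinner, Subtype.mk.injEq]
    by_cases hij : i = j
    · subst hij
      have h2 : (√(l i) : ℂ) ≠ 0 := by
        have : √(l i) ≠ 0 := by rw [Real.sqrt_ne_zero (hl0 i)]; exact hi
        exact_mod_cast this
      simp only [if_true, ← hsq i, map_inv₀, Complex.conj_ofReal]
      field_simp
    · simp [hij]
  obtain ⟨b, hb⟩ := hv.exists_orthonormalBasis_extension_of_card_eq (by simp)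
  let B : Matrix κ κ ℂ := Matrix.of fun i j => b j i
  refine ⟨B, V, fun i => √(l i), ?_, hV, hV', fun i => Real.sqrt_nonneg _, ?_⟩
  · ext i j
    have := orthonormal_iff_ite.1 b.orthonormal i j
    rw [Matrix.one_apply, ← this, Matrix.mul_apply, PiLp.inner_apply]
    exact Finset.sum_congr rfl fun x _ => by simp [B, mul_comm]
  · have : K * V = B * diagonal (fun i => (√(l i) : ℂ)) := by
      ext i j
      rw [mul_diagonal]
      by_cases h : l j = 0
      · have hc : c j = 0 := by
          rw [← inner_self_eq_zero (𝕜 := ℂ), hinner]; simp [h]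
        have := congrArg (fun w : EuclideanSpace ℂ κ => w i) hc
        simp only [c] at this
        simpa [h] using this
      · have h2 : (√(l j) : ℂ) ≠ 0 := by
          have : √(l j) ≠ 0 := by rw [Real.sqrt_ne_zero (hl0 j)]; exact h
          exact_mod_cast this
        simp only [B, Matrix.of_apply, hb j h, v, c, PiLp.smul_apply, smul_eq_mul]
        field_simp
    calc K = K * V * Vᴴ := by rw [Matrix.mul_assoc, hV', Matrix.mul_one]
      _ = _ := by rw [this]

end Spectral

/-! ### Maximal overlap over contractions. -/

section MaximalOverlap

variable {ι κ μ : Type*} [Fintype ι] [Fintype κ] [Fintype μ]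

theorem re_trace_mul_nonneg {P Q : Matrix κ κ ℂ} (hP : P.PosSemidef) (hQ : Q.PosSemidef) :
    0 ≤ (trace (P * Q)).re := by
  classical
  obtain ⟨V, -, -, h⟩ := exists_unitary_diagonalization hQ.1
  set s : Matrix κ κ ℂ := diagonal (fun i => ((√(hQ.1.eigenvalues i) : ℝ) : ℂ)) with hs
  have hd : diagonal (fun i => (hQ.1.eigenvalues i : ℂ)) = s * s := by
    rw [hs, diagonal_mul_diagonal]; congr 1; ext i
    exact_mod_cast (Real.mul_self_sqrt (hQ.eigenvalues_nonneg i)).symm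
  have sH : sᴴ = s := by
    rw [hs, diagonal_conjTranspose]; congr 1; ext i; simp
  have : trace (P * Q) = trace ((V * s)ᴴ * P * (V * s)) := by
    rw [h, hd, conjTranspose_mul, sH, ← Matrix.mul_assoc, Matrix.trace_mul_comm,
      ← Matrix.mul_assoc, ← Matrix.mul_assoc, ← Matrix.mul_assoc, Matrix.trace_mul_comm (_ * s) s]
    simp only [Matrix.mul_assoc]
  rw [this]
  exact (Complex.nonneg_iff.1 (hP.conjTranspose_mul_mul_same _).trace_nonneg).1

/-- The energy functional `K ↦ Re Tr[K ρ K† A]`. -/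
noncomputable def overlap (A : Matrix ι ι ℂ) (ρ : Matrix κ κ ℂ) (K : Matrix ι κ ℂ) : ℝ :=
  (trace (K * ρ * Kᴴ * A)).re

/-- Contractions between finite-dimensional Hilbert spaces. -/
abbrev Contraction (ι κ : Type*) [Fintype ι] [Fintype κ] [DecidableEq κ] :=
  {K : Matrix ι κ ℂ // (1 - Kᴴ * K).PosSemidef}

instance [DecidableEq κ] : Nonempty (Contraction ι κ) :=
  ⟨⟨0, by simpa using PosSemidef.one⟩⟩

/-- The maximum of `Re Tr[K ρ K† A]` over all contractions `K`. -/
noncomputable def maxOverlap [DecidableEq κ] (A : Matrix ι ι ℂ) (ρ : Matrix κ κ ℂ) : ℝ :=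
  ⨆ K : Contraction ι κ, overlap A ρ K

theorem overlap_nonneg {A : Matrix ι ι ℂ} {ρ : Matrix κ κ ℂ} (hA : A.PosSemidef)
    (hρ : ρ.PosSemidef) (K : Matrix ι κ ℂ) : 0 ≤ overlap A ρ K :=
  re_trace_mul_nonneg (hρ.mul_mul_conjTranspose_same K) hA

theorem bddAbove_overlap [DecidableEq κ] {A : Matrix ι ι ℂ} {ρ : Matrix κ κ ℂ}
    (hA : A.PosSemidef) (hρ : ρ.PosSemidef) :
    BddAbove (Set.range fun K : Contraction ι κ => overlap A ρ K) := by
  classical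
  obtain ⟨c, hc⟩ := exists_add_smul_posSemidef hA.1.neg
  refine ⟨|c| * (trace ρ).re, ?_⟩
  rintro _ ⟨⟨K, hK⟩, rfl⟩
  have h1 := re_trace_mul_nonneg (hρ.mul_mul_conjTranspose_same K) hc
  have h2 := re_trace_mul_nonneg hρ hK
  have h3 := re_trace_mul_nonneg hρ (posSemidef_conjTranspose_mul_self K)
  have h4 : trace (K * ρ * Kᴴ) = trace (ρ * (Kᴴ * K)) := by
    rw [Matrix.mul_assoc, Matrix.trace_mul_comm, Matrix.mul_assoc]
  rw [Matrix.mul_add, Matrix.mul_neg, Matrix.mul_smul, Matrix.mul_one, trace_add, trace_neg,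
    trace_smul, h4] at h1
  rw [Matrix.mul_sub, Matrix.mul_one, trace_sub] at h2
  simp only [overlap]
  simp only [Complex.add_re, Complex.neg_re, smul_eq_mul, Complex.re_ofReal_mul,
    Complex.sub_re] at h1 h2
  calc (trace (K * ρ * Kᴴ * A)).re ≤ c * (trace (ρ * (Kᴴ * K))).re := by linarith
    _ ≤ |c| * (trace (ρ * (Kᴴ * K))).re := by gcongr; exact le_abs_self c
    _ ≤ |c| * (trace ρ).re := mul_le_mul_of_nonneg_left (by linarith) (abs_nonneg c)

theorem overlap_le_maxOverlap [DecidableEq κ] {A : Matrix ι ι ℂ} {ρ : Matrix κ κ ℂ}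
    (hA : A.PosSemidef) (hρ : ρ.PosSemidef) {K : Matrix ι κ ℂ} (hK : (1 - Kᴴ * K).PosSemidef) :
    overlap A ρ K ≤ maxOverlap A ρ :=
  le_ciSup (bddAbove_overlap hA hρ) (⟨K, hK⟩ : Contraction ι κ)

theorem contraction_mul [DecidableEq κ] [DecidableEq μ] {K : Matrix ι κ ℂ} {L : Matrix κ μ ℂ}
    (hK : (1 - Kᴴ * K).PosSemidef) (hL : (1 - Lᴴ * L).PosSemidef) :
    (1 - (K * L)ᴴ * (K * L)).PosSemidef := by
  have : 1 - (K * L)ᴴ * (K * L) = (1 - Lᴴ * L) + Lᴴ * (1 - Kᴴ * K) * L := by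
    simp only [conjTranspose_mul, Matrix.mul_sub, Matrix.sub_mul, Matrix.mul_one, Matrix.mul_assoc]
    abel
  rw [this]
  exact hL.add (hK.conjTranspose_mul_mul_same L)

/-- A contraction `K` tested on `X X†` is replaced by `K W` tested on `X† X`, where `X = W X† W`.
The overlap does not drop because `W X† X W† - X X† = W X† (1 - W W†) X W†` is positive. -/
theorem maxOverlap_mul_conjTranspose_le [DecidableEq κ] [DecidableEq μ] {A : Matrix ι ι ℂ}
    (hA : A.PosSemidef) (X : Matrix κ μ ℂ) :
    maxOverlap A (X * Xᴴ) ≤ maxOverlap A (Xᴴ * X) := by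
  refine ciSup_le fun ⟨K, hK⟩ => ?_
  obtain ⟨W, hW, hW', hX⟩ := exists_eq_mul_conjTranspose_mul X
  refine le_trans ?_ (overlap_le_maxOverlap hA (posSemidef_conjTranspose_mul_self X)
    (contraction_mul hK hW))
  have h := re_trace_mul_nonneg (hW'.mul_mul_conjTranspose_same (K * W * Xᴴ)) hA
  have e : K * W * Xᴴ * (1 - W * Wᴴ) * (K * W * Xᴴ)ᴴ * A =
      K * W * (Xᴴ * X) * (K * W)ᴴ * A - K * (X * Xᴴ) * Kᴴ * A := by
    have : X * Xᴴ = W * Xᴴ * W * Wᴴ * X * Wᴴ := by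
      conv_lhs => rw [hX]
      simp only [conjTranspose_mul, conjTranspose_conjTranspose, Matrix.mul_assoc]
    rw [this]
    simp only [conjTranspose_mul, conjTranspose_conjTranspose, Matrix.mul_sub, Matrix.sub_mul,
      Matrix.mul_one, Matrix.mul_assoc]
  rw [e, trace_sub, Complex.sub_re] at h
  simp only [overlap]
  linarith

theorem maxOverlap_mul_conjTranspose [DecidableEq κ] [DecidableEq μ] {A : Matrix ι ι ℂ}
    (hA : A.PosSemidef) (X : Matrix κ μ ℂ) :
    maxOverlap A (X * Xᴴ) = maxOverlap A (Xᴴ * X) := by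
  refine le_antisymm (maxOverlap_mul_conjTranspose_le hA X) ?_
  simpa using maxOverlap_mul_conjTranspose_le hA Xᴴ

/-- The isometry is undone by the contraction `V†`, which is absorbed into `K`. -/
theorem maxOverlap_le_conj_isometry [DecidableEq κ] [DecidableEq μ] {A : Matrix ι ι ℂ}
    {ρ : Matrix κ κ ℂ} (hA : A.PosSemidef) (hρ : ρ.PosSemidef) {V : Matrix μ κ ℂ}
    (hV : Vᴴ * V = 1) : maxOverlap A ρ ≤ maxOverlap A (V * ρ * Vᴴ) := by
  refine ciSup_le fun ⟨K, hK⟩ => ?_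
  have hVV : (1 - V * Vᴴ).PosSemidef := by
    refine posSemidef_one_sub_of_projection (by simp) ?_
    calc V * Vᴴ * (V * Vᴴ) = V * (Vᴴ * V) * Vᴴ := by simp only [Matrix.mul_assoc]
      _ = _ := by rw [hV, Matrix.mul_one]
  refine le_trans (le_of_eq ?_) (overlap_le_maxOverlap hA (hρ.mul_mul_conjTranspose_same V)
    (contraction_mul hK (L := Vᴴ) (by simpa using hVV)))
  have : K * Vᴴ * (V * ρ * Vᴴ) * (K * Vᴴ)ᴴ = K * (Vᴴ * V) * ρ * (Vᴴ * V) * Kᴴ := by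
    simp only [conjTranspose_mul, conjTranspose_conjTranspose, Matrix.mul_assoc]
  simp only [overlap]
  rw [this, hV, Matrix.mul_one, Matrix.mul_one]

theorem maxOverlap_sum_le [DecidableEq κ] {A : Matrix ι ι ℂ} (hA : A.PosSemidef)
    {σ : Type*} (s : Finset σ) {ρ : σ → Matrix κ κ ℂ} (hρ : ∀ k, (ρ k).PosSemidef) :
    maxOverlap A (∑ k ∈ s, ρ k) ≤ ∑ k ∈ s, maxOverlap A (ρ k) := by
  refine ciSup_le fun ⟨K, hK⟩ => ?_
  have : overlap A (∑ k ∈ s, ρ k) K = ∑ k ∈ s, overlap A (ρ k) K := by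
    simp only [overlap, Matrix.mul_sum, Matrix.sum_mul, trace_sum, Complex.re_sum]
  rw [this]
  exact Finset.sum_le_sum fun k _ => overlap_le_maxOverlap hA (hρ k) hK

theorem maxOverlap_smul [DecidableEq κ] (A : Matrix ι ι ℂ) (ρ : Matrix κ κ ℂ) {c : ℝ}
    (hc : 0 ≤ c) : maxOverlap A ((c : ℂ) • ρ) = c * maxOverlap A ρ := by
  rw [maxOverlap, maxOverlap, Real.mul_iSup_of_nonneg hc]
  simp [overlap]

/-- Every contraction on a space is the average of two unitaries. -/
theorem exists_unitary_average [DecidableEq κ] {K : Matrix κ κ ℂ} (hK : (1 - Kᴴ * K).PosSemidef) :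
    ∃ U V : Matrix.unitaryGroup κ ℂ, (2 : ℂ) • K = (U : Matrix κ κ ℂ) + (V : Matrix κ κ ℂ) := by
  obtain ⟨B, V, s, hB, hV, hV', hs, rfl⟩ := exists_singular_value_decomposition K
  have hs1 : ∀ i, s i ^ 2 ≤ 1 := by
    intro i
    have h := (hK.conjTranspose_mul_mul_same V).diag_nonneg (i := i)
    have e : Vᴴ * (1 - (B * diagonal (fun i => (s i : ℂ)) * Vᴴ)ᴴ *
        (B * diagonal (fun i => (s i : ℂ)) * Vᴴ)) * V =
        1 - diagonal (fun i => ((s i ^ 2 : ℝ) : ℂ)) := by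
      calc _ = Vᴴ * V - (Vᴴ * V) * (diagonal (fun i => (s i : ℂ)))ᴴ * (Bᴴ * B) *
            diagonal (fun i => (s i : ℂ)) * (Vᴴ * V) := by
            simp only [conjTranspose_mul, conjTranspose_conjTranspose, Matrix.mul_sub,
              Matrix.sub_mul, Matrix.mul_one, Matrix.mul_assoc]
        _ = _ := by
            rw [hV, hB, Matrix.one_mul, Matrix.mul_one, Matrix.mul_one, diagonal_conjTranspose,
              diagonal_mul_diagonal]
            congr 2; ext i; simp [sq]
    rw [e, Matrix.sub_apply, one_apply_eq, diagonal_apply_eq] at h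
    have : (0 : ℝ) ≤ 1 - s i ^ 2 := by exact_mod_cast h
    linarith
  have unit : ∀ z : κ → ℂ, (∀ i, star (z i) * z i = 1) →
      B * diagonal z * Vᴴ ∈ Matrix.unitaryGroup κ ℂ := by
    intro z hz
    rw [Matrix.mem_unitaryGroup_iff', star_eq_conjTranspose]
    calc (B * diagonal z * Vᴴ)ᴴ * (B * diagonal z * Vᴴ)
        = V * (diagonal z)ᴴ * (Bᴴ * B) * diagonal z * Vᴴ := by
          simp only [conjTranspose_mul, conjTranspose_conjTranspose, Matrix.mul_assoc]
      _ = V * ((diagonal z)ᴴ * diagonal z) * Vᴴ := by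
          rw [hB]; simp only [Matrix.mul_assoc, Matrix.one_mul]
      _ = 1 := by
          have : (diagonal z)ᴴ * diagonal z = 1 := by
            rw [diagonal_conjTranspose, diagonal_mul_diagonal, ← diagonal_one]
            congr 1; ext i; exact hz i
          rw [this, Matrix.mul_one, hV']
  have hr : ∀ i, √(1 - s i ^ 2) * √(1 - s i ^ 2) = 1 - s i ^ 2 := fun i =>
    Real.mul_self_sqrt (by linarith [hs1 i])
  -- A singular value `s ∈ [0, 1]` is the average of the two phases `s ± i √(1 - s²)`.
  refine ⟨⟨_, unit (fun i => ⟨s i, √(1 - s i ^ 2)⟩) ?_⟩,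
    ⟨_, unit (fun i => ⟨s i, -√(1 - s i ^ 2)⟩) ?_⟩, ?_⟩
  · intro i; apply Complex.ext <;> simp <;> nlinarith [hr i]
  · intro i; apply Complex.ext <;> simp <;> nlinarith [hr i]
  · simp only
    rw [← Matrix.add_mul, ← Matrix.mul_add, diagonal_add, ← Matrix.smul_mul, ← Matrix.mul_smul,
      ← diagonal_smul]
    congr 3
    ext i
    apply Complex.ext <;> simp; ring

/-- The overlap is a nonnegative quadratic form in `K`. For `2K = U + V`, the parallelogram identity
bounds its value at `K` by the average of its values at `U` and `V`. -/
theorem iSup_unitary_overlap [DecidableEq κ] {A ρ : Matrix κ κ ℂ} (hA : A.PosSemidef)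
    (hρ : ρ.PosSemidef) :
    BddAbove (Set.range fun U : Matrix.unitaryGroup κ ℂ => overlap A ρ U) ∧
      ⨆ U : Matrix.unitaryGroup κ ℂ, overlap A ρ U = maxOverlap A ρ := by
  have hU : ∀ U : Matrix.unitaryGroup κ ℂ, overlap A ρ U ≤ maxOverlap A ρ := by
    intro U
    refine overlap_le_maxOverlap hA hρ ?_
    have := Matrix.mem_unitaryGroup_iff'.1 U.2
    rw [star_eq_conjTranspose] at this
    rw [this, sub_self]
    exact PosSemidef.zero
  have hbdd : BddAbove (Set.range fun U : Matrix.unitaryGroup κ ℂ => overlap A ρ U) :=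
    ⟨_, by rintro _ ⟨U, rfl⟩; exact hU U⟩
  refine ⟨hbdd, le_antisymm (ciSup_le hU) (ciSup_le fun ⟨K, hK⟩ => ?_)⟩
  obtain ⟨U, V, hUV⟩ := exists_unitary_average hK
  have h1 := le_ciSup hbdd U
  have h2 := le_ciSup hbdd V
  have h3 := overlap_nonneg hA hρ ((U : Matrix κ κ ℂ) - V)
  have par : overlap A ρ ((2 : ℂ) • K) + overlap A ρ ((U : Matrix κ κ ℂ) - V) =
      2 * overlap A ρ U + 2 * overlap A ρ V := by
    rw [hUV]
    simp only [overlap, conjTranspose_add, conjTranspose_sub, Matrix.add_mul, Matrix.mul_add,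
      Matrix.sub_mul, Matrix.mul_sub, trace_add, trace_sub, Complex.add_re, Complex.sub_re]
    ring
  have four : overlap A ρ ((2 : ℂ) • K) = 4 * overlap A ρ K := by
    simp [overlap, conjTranspose_smul]
    ring
  simp only at h1 h2 ⊢
  linarith

end MaximalOverlap

/-! ### Capacity through maximal overlaps; pure states. -/

section Capacity

variable {κ : Type*}

theorem pureState_eq_vecMulVec (Ψ : EuclideanSpace ℂ κ) :
    pureState Ψ = vecMulVec Ψ.ofLp (star Ψ.ofLp) := rfl

variable [Fintype κ]

/-- The squared Euclidean norm of a vector. -/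
noncomputable def sqNorm (v : κ → ℂ) : ℝ := (star v ⬝ᵥ v).re

theorem sqNorm_nonneg (v : κ → ℂ) : 0 ≤ sqNorm v :=
  (Complex.nonneg_iff.1 (dotProduct_star_self_nonneg v)).1

theorem star_dotProduct_self (v : κ → ℂ) : star v ⬝ᵥ v = (sqNorm v : ℂ) := by
  have h := Complex.nonneg_iff.1 (dotProduct_star_self_nonneg v)
  exact Complex.ext (by simp [sqNorm]) (by simpa using h.2.symm)

theorem trace_vecMulVec_star (v : κ → ℂ) : trace (vecMulVec v (star v)) = (sqNorm v : ℂ) := by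
  rw [trace_vecMulVec, dotProduct_comm, star_dotProduct_self]

theorem mul_vecMulVec_star_mul {κ' : Type*} [Fintype κ'] (M : Matrix κ' κ ℂ) (v : κ → ℂ) :
    M * vecMulVec v (star v) * Mᴴ = vecMulVec (M *ᵥ v) (star (M *ᵥ v)) := by
  rw [mul_vecMulVec, vecMulVec_mul, star_mulVec]

theorem sqNorm_ofLp (Ψ : EuclideanSpace ℂ κ) : sqNorm Ψ.ofLp = ‖Ψ‖ ^ 2 := by
  have h : inner ℂ Ψ Ψ = star Ψ.ofLp ⬝ᵥ Ψ.ofLp := by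
    rw [EuclideanSpace.inner_eq_star_dotProduct, dotProduct_comm]
  rw [sqNorm, ← h, inner_self_eq_norm_sq_to_K]
  norm_cast

variable [DecidableEq κ]

/-- The capacity of a positive operator in terms of maximal overlaps with two positive shifts
of the Hamiltonian. -/
theorem capacity_eq_maxOverlap {ρ H : Matrix κ κ ℂ} (hρ : ρ.PosSemidef) {α β : ℝ}
    (hα : (H + (α : ℂ) • 1).PosSemidef) (hβ : (-H + (β : ℂ) • 1).PosSemidef) :
    capacity ρ H = maxOverlap (H + (α : ℂ) • 1) ρ + maxOverlap (-H + (β : ℂ) • 1) ρ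
      - (α + β) * (trace ρ).re := by
  obtain ⟨b1, e1⟩ := iSup_unitary_overlap hα hρ
  obtain ⟨b2, e2⟩ := iSup_unitary_overlap hβ hρ
  have htr : ∀ U : Matrix.unitaryGroup κ ℂ,
      (trace ((U : Matrix κ κ ℂ) * ρ * (U : Matrix κ κ ℂ)ᴴ)).re = (trace ρ).re := by
    intro U
    have := Matrix.mem_unitaryGroup_iff'.1 U.2
    rw [star_eq_conjTranspose] at this
    rw [Matrix.trace_mul_comm, ← Matrix.mul_assoc, this, Matrix.one_mul]
  set t := (trace (ρ * H)).re with ht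
  have w1 : ∀ U : Matrix.unitaryGroup κ ℂ, extractedWork ρ H U =
      (t + α * (trace ρ).re) - overlap (H + (α : ℂ) • 1) ρ U := by
    intro U
    simp only [extractedWork, overlap, Matrix.mul_add, Matrix.mul_smul, Matrix.mul_one,
      trace_add, trace_smul, Complex.add_re, Complex.sub_re, smul_eq_mul, Complex.re_ofReal_mul,
      htr]
    ring
  have w2 : ∀ U : Matrix.unitaryGroup κ ℂ, extractedWork ρ H U =
      overlap (-H + (β : ℂ) • 1) ρ U + (t - β * (trace ρ).re) := by
    intro U
    simp only [extractedWork, overlap, Matrix.mul_add, Matrix.mul_smul, Matrix.mul_one,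
      Matrix.mul_neg, trace_neg, trace_add, trace_smul, Complex.add_re, Complex.sub_re,
      Complex.neg_re, smul_eq_mul, Complex.re_ofReal_mul, htr]
    ring
  have h1 : antiergotropy ρ H = (t + α * (trace ρ).re) - maxOverlap (H + (α : ℂ) • 1) ρ := by
    rw [antiergotropy, ← e1]
    simp only [w1]
    refine le_antisymm ?_ (le_ciInf fun U => by linarith [le_ciSup b1 U])
    have hb : BddBelow (Set.range fun U : Matrix.unitaryGroup κ ℂ =>
        (t + α * (trace ρ).re) - overlap (H + (α : ℂ) • 1) ρ U) := by
      obtain ⟨c, hc⟩ := b1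
      refine ⟨t + α * (trace ρ).re - c, ?_⟩
      rintro _ ⟨U, rfl⟩
      have := hc ⟨U, rfl⟩
      simp only at this ⊢
      linarith
    rw [le_sub_comm]
    exact ciSup_le fun U => by linarith [ciInf_le hb U]
  have h2 : ergotropy ρ H = maxOverlap (-H + (β : ℂ) • 1) ρ + (t - β * (trace ρ).re) := by
    rw [ergotropy, ← e2, ciSup_add b2]
    simp only [w2]
  rw [capacity, h1, h2]
  ring

theorem capacity_smul (ρ H : Matrix κ κ ℂ) {c : ℝ} (hc : 0 ≤ c) :
    capacity ((c : ℂ) • ρ) H = c * capacity ρ H := by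
  have : ∀ U, extractedWork ((c : ℂ) • ρ) H U = c * extractedWork ρ H U := by
    intro U
    simp only [extractedWork, Matrix.smul_mul, Matrix.mul_smul, trace_smul, smul_eq_mul,
      ← mul_sub, Complex.re_ofReal_mul]
  simp only [capacity, ergotropy, antiergotropy, this, ← Real.mul_iSup_of_nonneg hc,
    ← Real.mul_iInf_of_nonneg hc, mul_sub]

/-- The capacity of an unnormalized pure state is proportional to its squared norm. -/
theorem exists_capacity_vecMulVec {H : Matrix κ κ ℂ} (hH : H.IsHermitian) :
    ∃ c : ℝ, ∀ v : κ → ℂ, capacity (vecMulVec v (star v)) H = c * sqNorm v := by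
  obtain ⟨α, hα⟩ := exists_add_smul_posSemidef hH
  obtain ⟨β, hβ⟩ := exists_add_smul_posSemidef hH.neg
  have key : ∀ {A : Matrix κ κ ℂ}, A.PosSemidef → ∀ v : κ → ℂ,
      maxOverlap A (vecMulVec v (star v)) =
        sqNorm v * maxOverlap A (1 : Matrix Unit Unit ℂ) := by
    intro A hA v
    -- Exchanging `X X†` for `X† X` with `X` a single column leaves a one-dimensional system, so `v`
    -- enters only through its norm.
    have h1 : vecMulVec v (star v) = replicateCol Unit v * (replicateCol Unit v)ᴴ := by
      ext i j; simp [vecMulVec_apply, Matrix.mul_apply]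
    have h2 : (replicateCol Unit v)ᴴ * replicateCol Unit v =
        (sqNorm v : ℂ) • (1 : Matrix Unit Unit ℂ) := by
      ext i j
      rw [← star_dotProduct_self]
      simp [Matrix.mul_apply, dotProduct]
    rw [h1, maxOverlap_mul_conjTranspose hA, h2, maxOverlap_smul _ _ (sqNorm_nonneg v)]
  refine ⟨maxOverlap (H + (α : ℂ) • 1) (1 : Matrix Unit Unit ℂ) +
    maxOverlap (-H + (β : ℂ) • 1) (1 : Matrix Unit Unit ℂ) - (α + β), fun v => ?_⟩
  rw [capacity_eq_maxOverlap (posSemidef_vecMulVec_self_star v) hα hβ, key hα, key hβ,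
    trace_vecMulVec_star, Complex.ofReal_re]
  ring

end Capacity

/-! ### Tensor products of operators. -/

section TensorProducts

variable {ι : Type*} [Fintype ι]

/-- The tensor product of a family of operators over an arbitrary finite index type. -/
def piOp {α β : ι → Type*} (K : ∀ i, Matrix (β i) (α i) ℂ) :
    Matrix (∀ i, β i) (∀ i, α i) ℂ :=
  Matrix.of fun x y => ∏ i, K i (x i) (y i)

theorem piOp_conjTranspose_mul [DecidableEq ι] {α β : ι → Type*} [∀ i, Fintype (β i)]
    (K : ∀ i, Matrix (β i) (α i) ℂ) :
    (piOp K)ᴴ * piOp K = piOp fun i => (K i)ᴴ * K i := by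
  ext x y
  simp only [piOp, Matrix.mul_apply, conjTranspose_apply, Matrix.of_apply, star_prod,
    ← Finset.prod_mul_distrib]
  rw [Finset.prod_univ_sum, Fintype.piFinset_univ]

theorem piOp_one {α : ι → Type*} [∀ i, DecidableEq (α i)] :
    piOp (fun i => (1 : Matrix (α i) (α i) ℂ)) = 1 := by
  ext x y
  simp only [piOp, Matrix.of_apply, Matrix.one_apply]
  by_cases h : x = y
  · simp [h]
  · obtain ⟨i, hi⟩ := Function.ne_iff.1 h
    rw [if_neg h]
    exact Finset.prod_eq_zero (Finset.mem_univ i) (if_neg hi)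

/-- Only the factor at `a` depends on `k`, so the sum passes to that factor. -/
theorem sum_piOp_eq_one [DecidableEq ι] {α : ι → Type*} [∀ i, DecidableEq (α i)] (a : ι) {m : ℕ}
    (T : Fin m → ∀ i, Matrix (α i) (α i) ℂ) (ha : ∑ k, T k a = 1)
    (hne : ∀ k j, j ≠ a → T k j = 1) : ∑ k, piOp (T k) = 1 := by
  rw [← piOp_one]
  ext x y
  simp only [Matrix.sum_apply, piOp, Matrix.of_apply, Fintype.prod_eq_mul_prod_subtype_ne _ a]
  have h1 : ∀ k, ∏ j : {j // j ≠ a}, T k j (x j) (y j) =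
      ∏ j : {j // j ≠ a}, (1 : Matrix (α j) (α j) ℂ) (x j) (y j) := fun k =>
    Finset.prod_congr rfl fun j _ => by rw [hne k j j.2]
  simp only [h1, ← Finset.sum_mul]
  rw [← ha, Matrix.sum_apply]

end TensorProducts

/-! ### Reduced states of pure states and a single LOCC round. -/

section Reduction

variable {n : ℕ} {d e : Fin n → ℕ}

/-- A vector of the composite system as a matrix with respect to the split `i | rest`. -/
def partyMatrix (i : Fin n) (v : (∀ j, Fin (d j)) → ℂ) :
    Matrix (Fin (d i)) (∀ j : {j // j ≠ i}, Fin (d j)) ℂ :=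
  Matrix.of fun a y => v ((Equiv.piSplitAt i fun j => Fin (d j)).symm (a, y))

theorem piSplitAt_symm_self (i : Fin n) (a : Fin (d i)) (y : ∀ j : {j // j ≠ i}, Fin (d j)) :
    (Equiv.piSplitAt i fun j => Fin (d j)).symm (a, y) i = a := by
  simp

theorem piSplitAt_symm_of_ne (i : Fin n) (a : Fin (d i)) (y : ∀ j : {j // j ≠ i}, Fin (d j))
    (j : {j // j ≠ i}) : (Equiv.piSplitAt i fun j => Fin (d j)).symm (a, y) j = y j := by
  simp [j.2]

theorem update_piSplitAt_symm (i : Fin n) (a b : Fin (d i))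
    (y : ∀ j : {j // j ≠ i}, Fin (d j)) :
    Function.update ((Equiv.piSplitAt i fun j => Fin (d j)).symm (a, y)) i b =
      (Equiv.piSplitAt i fun j => Fin (d j)).symm (b, y) := by
  ext j
  by_cases h : j = i
  · subst h; simp
  · simp [h]

theorem reducedState_vecMulVec (i : Fin n) (v : (∀ j, Fin (d j)) → ℂ) :
    reducedState i (vecMulVec v (star v)) = partyMatrix i v * (partyMatrix i v)ᴴ := by
  ext a b
  simp only [reducedState, Matrix.of_apply, Finset.sum_filter]
  rw [← (Equiv.piSplitAt i fun j => Fin (d j)).symm.sum_comp, Fintype.sum_prod_type]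
  simp only [piSplitAt_symm_self, update_piSplitAt_symm]
  rw [Finset.sum_eq_single a (fun a' _ h => by simp [h]) (by simp)]
  simp [Matrix.mul_apply, partyMatrix, vecMulVec_apply]

theorem trace_reducedState_vecMulVec (i : Fin n) (v : (∀ j, Fin (d j)) → ℂ) :
    (trace (reducedState i (vecMulVec v (star v)))).re = sqNorm v := by
  have : trace (reducedState i (vecMulVec v (star v))) = trace (vecMulVec v (star v)) := by
    rw [reducedState_vecMulVec]
    simp only [trace, diag_apply, Matrix.mul_apply]
    rw [← (Equiv.piSplitAt i fun j => Fin (d j)).symm.sum_comp, Fintype.sum_prod_type]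
    rfl
  rw [this, trace_vecMulVec_star, Complex.ofReal_re]

theorem partyMatrix_prodOp (i : Fin n) (K : ∀ j, Matrix (Fin (e j)) (Fin (d j)) ℂ)
    (v : (∀ j, Fin (d j)) → ℂ) :
    partyMatrix i (prodOp K *ᵥ v) =
      K i * partyMatrix i v * (piOp fun j : {j // j ≠ i} => K j)ᵀ := by
  ext a y
  simp only [partyMatrix, Matrix.of_apply, mulVec, dotProduct, prodOp, Matrix.mul_apply,
    transpose_apply, piOp, Finset.sum_mul]
  rw [← (Equiv.piSplitAt i fun j => Fin (d j)).symm.sum_comp, Fintype.sum_prod_type_right]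
  refine Finset.sum_congr rfl fun z _ => Finset.sum_congr rfl fun b _ => ?_
  rw [Fintype.prod_eq_mul_prod_subtype_ne _ i]
  simp only [piSplitAt_symm_self, piSplitAt_symm_of_ne]
  ring

/-- In the reduced state of `i`, the operators of the other parties survive only as `K j† K j`;
isometries among them disappear. -/
theorem partyMatrix_prodOp_mul_conjTranspose (i : Fin n)
    (K : ∀ j, Matrix (Fin (e j)) (Fin (d j)) ℂ) (v : (∀ j, Fin (d j)) → ℂ) :
    partyMatrix i (prodOp K *ᵥ v) * (partyMatrix i (prodOp K *ᵥ v))ᴴ =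
      K i * (partyMatrix i v * (piOp fun j : {j // j ≠ i} => (K j)ᴴ * K j)ᵀ
        * (partyMatrix i v)ᴴ) * (K i)ᴴ := by
  have h : ((piOp fun j : {j // j ≠ i} => K j)ᵀ)ᴴ = ((piOp fun j : {j // j ≠ i} => K j)ᴴ)ᵀ := rfl
  rw [partyMatrix_prodOp, ← piOp_conjTranspose_mul, transpose_mul, conjTranspose_mul,
    conjTranspose_mul, h]
  simp only [Matrix.mul_assoc]

/-- In one round of an LOCC protocol on a pure state, maximal overlaps of reduced states do not
decrease on average. -/
theorem maxOverlap_reducedState_le_sum {ι : Type*} [Fintype ι] {A : Matrix ι ι ℂ}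
    (hA : A.PosSemidef) (i a : Fin n) {m : ℕ} {f : Fin m → Fin n → ℕ}
    (K : ∀ (k : Fin m) (j : Fin n), Matrix (Fin (f k j)) (Fin (d j)) ℂ)
    (measurement : ∑ k, (K k a)ᴴ * K k a = 1)
    (isometries : ∀ k j, j ≠ a → (K k j)ᴴ * K k j = 1) (v : (∀ j, Fin (d j)) → ℂ) :
    maxOverlap A (reducedState i (vecMulVec v (star v))) ≤
      ∑ k, maxOverlap A
        (reducedState i (vecMulVec (prodOp (K k) *ᵥ v) (star (prodOp (K k) *ᵥ v)))) := by
  simp only [reducedState_vecMulVec, partyMatrix_prodOp_mul_conjTranspose]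
  set X := partyMatrix i v
  by_cases hia : i = a
  -- Party `i` itself measures: the other factors become identities, and `X† X` splits along the
  -- outcomes.
  · subst hia
    have h1 : ∀ k, (piOp fun j : {j // j ≠ i} => (K k j)ᴴ * K k j) = 1 := by
      intro k
      rw [← piOp_one]
      congr 1
      ext1 j
      exact isometries k j j.2
    have h2 : ∀ k : Fin m, maxOverlap A (K k i * (X * Xᴴ) * (K k i)ᴴ) =
        maxOverlap A ((K k i * X)ᴴ * (K k i * X)) := by
      intro k
      rw [← maxOverlap_mul_conjTranspose hA, conjTranspose_mul]
      simp only [Matrix.mul_assoc]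
    simp only [h1, transpose_one, Matrix.mul_one, h2]
    have h3 : Xᴴ * X =
        ∑ k : Fin m, (K k i * X)ᴴ * (K k i * X) := by
      calc Xᴴ * X = Xᴴ * (∑ k : Fin m, (K k i)ᴴ * K k i) * X := by rw [measurement, Matrix.mul_one]
        _ = _ := by
          rw [Matrix.mul_sum, Matrix.sum_mul]
          exact Finset.sum_congr rfl fun k _ => by
            rw [conjTranspose_mul]; simp only [Matrix.mul_assoc]
    rw [maxOverlap_mul_conjTranspose hA, h3]
    exact maxOverlap_sum_le hA _ fun k => posSemidef_conjTranspose_mul_self _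
  -- The measuring party `a` is among the rest: its effects sum to the identity, which decomposes `X
  -- X†`.
  · have hsum : ∑ k, (piOp fun j : {j // j ≠ i} => (K k j)ᴴ * K k j) = 1 :=
      sum_piOp_eq_one (⟨a, fun h => hia h.symm⟩ : {j // j ≠ i})
        (fun k (j : {j // j ≠ i}) => (K k j)ᴴ * K k j) measurement
        fun k j hj => isometries k j fun h => hj (Subtype.ext h)
    have hX : X * Xᴴ =
        ∑ k, X * (piOp fun j : {j // j ≠ i} => (K k j)ᴴ * K k j)ᵀ * Xᴴ := by
      rw [← Matrix.sum_mul, ← Matrix.mul_sum, ← transpose_sum, hsum, transpose_one,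
        Matrix.mul_one]
    have hpos : ∀ k,
        (X * (piOp fun j : {j // j ≠ i} => (K k j)ᴴ * K k j)ᵀ * Xᴴ).PosSemidef := by
      intro k
      rw [← piOp_conjTranspose_mul]
      exact (posSemidef_conjTranspose_mul_self _).transpose.mul_mul_conjTranspose_same X
    rw [hX]
    exact (maxOverlap_sum_le hA _ hpos).trans (Finset.sum_le_sum fun k _ =>
      maxOverlap_le_conj_isometry hA (hpos k) (isometries k i hia))

theorem sum_sqNorm_prodOp (a : Fin n) {m : ℕ} {f : Fin m → Fin n → ℕ}
    (K : ∀ (k : Fin m) (j : Fin n), Matrix (Fin (f k j)) (Fin (d j)) ℂ)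
    (measurement : ∑ k, (K k a)ᴴ * K k a = 1)
    (isometries : ∀ k j, j ≠ a → (K k j)ᴴ * K k j = 1) (v : (∀ j, Fin (d j)) → ℂ) :
    ∑ k, sqNorm (prodOp (K k) *ᵥ v) = sqNorm v := by
  have hsum : ∑ k, (prodOp (K k))ᴴ * prodOp (K k) = 1 := by
    rw [← sum_piOp_eq_one a (fun k j => (K k j)ᴴ * K k j) measurement isometries]
    exact Finset.sum_congr rfl fun k _ => piOp_conjTranspose_mul (K k)
  have h : ∀ k, sqNorm (prodOp (K k) *ᵥ v) =
      (star v ⬝ᵥ (((prodOp (K k))ᴴ * prodOp (K k)) *ᵥ v)).re := by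
    intro k
    rw [sqNorm, star_mulVec, ← dotProduct_mulVec, mulVec_mulVec]
  simp only [h]
  rw [← Complex.re_sum, ← dotProduct_sum, ← Matrix.sum_mulVec, hsum, one_mulVec, sqNorm]

end Reduction

/-! ### Whole protocols and deterministic transformations. -/

section LOCC

variable {n : ℕ} {d e : Fin n → ℕ}

/-- A function of unnormalized pure states that does not decrease in any single round does not
decrease under the whole protocol. -/
theorem LOCCProtocol.le_sum_krausOps (F : ∀ d : Fin n → ℕ, ((∀ i, Fin (d i)) → ℂ) → ℝ)
    (hF : ∀ {d : Fin n → ℕ} (a : Fin n) (m : ℕ) (f : Fin m → Fin n → ℕ)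
      (K : ∀ (k : Fin m) (j : Fin n), Matrix (Fin (f k j)) (Fin (d j)) ℂ),
      ∑ k, (K k a)ᴴ * K k a = 1 → (∀ k j, j ≠ a → (K k j)ᴴ * K k j = 1) →
      ∀ v, F d v ≤ ∑ k, F (f k) (prodOp (K k) *ᵥ v))
    (P : LOCCProtocol e d) (v : (∀ i, Fin (d i)) → ℂ) :
    F d v ≤ (P.krausOps.map fun M => F e (M *ᵥ v)).sum := by
  induction P with
  | done => simp [krausOps]
  | round a m f K measurement isometries next ih =>
    refine (hF a m f K measurement isometries v).trans ?_
    rw [krausOps, List.map_flatMap, List.flatMap, List.sum_flatten, List.map_map,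
      Fin.sum_univ_def]
    refine List.sum_le_sum fun k _ => ?_
    simpa [Function.comp_def, ← mulVec_mulVec] using ih k (prodOp (K k) *ᵥ v)

theorem capacityGap_smul (H : ∀ i, Matrix (Fin (d i)) (Fin (d i)) ℂ)
    (ρ : Matrix (∀ i, Fin (d i)) (∀ i, Fin (d i)) ℂ) {c : ℝ} (hc : 0 ≤ c) :
    capacityGap H ((c : ℂ) • ρ) = c * capacityGap H ρ := by
  have : ∀ i, reducedState i ((c : ℂ) • ρ) = (c : ℂ) • reducedState i ρ := by
    intro i
    ext a b
    simp [reducedState, Finset.mul_sum]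
  simp only [capacityGap, this, capacity_smul _ _ hc, mul_sub, Finset.mul_sum]

theorem isHermitian_totalHamiltonian {H : ∀ i, Matrix (Fin (d i)) (Fin (d i)) ℂ}
    (hH : ∀ i, (H i).IsHermitian) : (totalHamiltonian H).IsHermitian := by
  rw [IsHermitian, totalHamiltonian, conjTranspose_sum]
  refine Finset.sum_congr rfl fun i _ => ?_
  ext x y
  simp only [localOp, prodOp, conjTranspose_apply, Matrix.of_apply, star_prod]
  refine Finset.prod_congr rfl fun j _ => ?_
  by_cases h : j = i
  · subst h; simpa using (hH j).apply (x j) (y j)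
  · simp [h, Matrix.one_apply, eq_comm]

/-- The capacity gap of unnormalized pure states does not increase under LOCC. -/
theorem capacityGap_vecMulVec_le {H : ∀ i, Matrix (Fin (d i)) (Fin (d i)) ℂ}
    (hH : ∀ i, (H i).IsHermitian) (P : LOCCProtocol d d) (v : (∀ i, Fin (d i)) → ℂ) :
    (P.krausOps.map fun M => capacityGap H (vecMulVec (M *ᵥ v) (star (M *ᵥ v)))).sum ≤
      capacityGap H (vecMulVec v (star v)) := by
  obtain ⟨c, hc⟩ := exists_capacity_vecMulVec (isHermitian_totalHamiltonian hH)
  choose α hα using fun i => exists_add_smul_posSemidef (hH i)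
  choose β hβ using fun i => exists_add_smul_posSemidef (hH i).neg
  -- `F` is minus the gap when `d' = d`. At intermediate dimensions the overlaps still refer to the
  -- final Hamiltonians, so `F` is defined along the whole protocol.
  let F : ∀ d' : Fin n → ℕ, ((∀ i, Fin (d' i)) → ℂ) → ℝ := fun d' w =>
    ∑ i, (maxOverlap (H i + (α i : ℂ) • 1) (reducedState i (vecMulVec w (star w))) +
      maxOverlap (-H i + (β i : ℂ) • 1) (reducedState i (vecMulVec w (star w)))) -
      (c + ∑ i, (α i + β i)) * sqNorm w
  have hgap : ∀ w, capacityGap H (vecMulVec w (star w)) = -F d w := by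
    intro w
    have hloc : ∀ i, capacity (reducedState i (vecMulVec w (star w))) (H i) =
        maxOverlap (H i + (α i : ℂ) • 1) (reducedState i (vecMulVec w (star w))) +
        maxOverlap (-H i + (β i : ℂ) • 1) (reducedState i (vecMulVec w (star w))) -
        (α i + β i) * sqNorm w := by
      intro i
      rw [← trace_reducedState_vecMulVec i w]
      refine capacity_eq_maxOverlap ?_ (hα i) (hβ i)
      rw [reducedState_vecMulVec]
      exact posSemidef_self_mul_conjTranspose _
    simp only [capacityGap, hc, hloc, Finset.sum_sub_distrib, ← Finset.sum_mul, F]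
    ring
  have hF := P.le_sum_krausOps F (fun {d'} a m f K hm hi w => by
    simp only [F, Finset.sum_sub_distrib, ← Finset.mul_sum, sum_sqNorm_prodOp a K hm hi]
    rw [Finset.sum_comm]
    refine sub_le_sub_right (Finset.sum_le_sum fun i _ => ?_) _
    rw [Finset.sum_add_distrib]
    exact add_le_add (maxOverlap_reducedState_le_sum (hα i) i a K hm hi w)
      (maxOverlap_reducedState_le_sum (hβ i) i a K hm hi w)) v
  simp only [hgap]
  have : (P.krausOps.map fun M => -F d (M *ᵥ v)).sum =
      -(P.krausOps.map fun M => F d (M *ᵥ v)).sum := by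
    simpa using List.sum_map_mul_left (r := (-1 : ℝ)) (l := P.krausOps)
      (f := fun M => F d (M *ᵥ v))
  linarith

/-- Homogeneity absorbs the probability. At probability zero, `M v = 0` and both sides vanish. -/
theorem outcomeProb_mul_capacityGap_postState (H : ∀ i, Matrix (Fin (d i)) (Fin (d i)) ℂ)
    (M : Matrix (∀ i, Fin (d i)) (∀ i, Fin (d i)) ℂ) (v : (∀ i, Fin (d i)) → ℂ) :
    outcomeProb M (vecMulVec v (star v)) *
        capacityGap H (postState M (vecMulVec v (star v))) =
      capacityGap H (vecMulVec (M *ᵥ v) (star (M *ᵥ v))) := by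
  have hnonneg : 0 ≤ outcomeProb M (vecMulVec v (star v)) := by
    rw [outcomeProb]
    exact (Complex.nonneg_iff.1
      ((posSemidef_vecMulVec_self_star v).mul_mul_conjTranspose_same M).trace_nonneg).1
  rw [postState, capacityGap_smul H _ (inv_nonneg.2 hnonneg), ← mul_assoc]
  by_cases h : outcomeProb M (vecMulVec v (star v)) = 0
  · have hz : M *ᵥ v = 0 := by
      rw [outcomeProb, mul_vecMulVec_star_mul, trace_vecMulVec_star, Complex.ofReal_re] at h
      rw [← dotProduct_star_self_eq_zero, star_dotProduct_self, h,
        Complex.ofReal_zero]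
    have h0 : capacityGap H (0 : Matrix (∀ i, Fin (d i)) (∀ i, Fin (d i)) ℂ) = 0 := by
      simpa using capacityGap_smul H 0 le_rfl
    rw [h, hz, zero_mul, zero_mul, zero_vecMulVec, h0]
  · rw [mul_inv_cancel₀ h, one_mul, mul_vecMulVec_star_mul]

/-- A pure state admits only trivial decompositions into pure states. -/
theorem eq_smul_of_sum_vecMulVec_eq {κ σ : Type*} [Fintype κ] [DecidableEq κ] {l : List σ}
    {w : σ → κ → ℂ} {u : κ → ℂ} (hu : sqNorm u = 1)
    (h : (l.map fun b => vecMulVec (w b) (star (w b))).sum = vecMulVec u (star u))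
    {b : σ} (hb : b ∈ l) : w b = (star u ⬝ᵥ w b) • u := by
  set c := star u ⬝ᵥ w b
  set z := w b - c • u with hz
  have huz : star u ⬝ᵥ z = 0 := by
    rw [hz, dotProduct_sub, dotProduct_smul, star_dotProduct_self, hu]
    simp [c]
  have hzu : star z ⬝ᵥ u = 0 := by
    have := congrArg star huz
    rwa [star_dotProduct, star_star, star_zero] at this
  -- `z` is the part of `w b` orthogonal to `u`. Evaluating both decompositions at `z` makes a sum
  -- of squares `|⟨z, w b'⟩|²` equal to `|⟨z, u⟩|² = 0`; hence `z` is orthogonal to `w b`, and so to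
  -- itself.
  let φ : Matrix κ κ ℂ →+ ℝ :=
    { toFun := fun ρ => (star z ⬝ᵥ (ρ *ᵥ z)).re
      map_zero' := by simp
      map_add' := fun ρ τ => by simp [add_mulVec, dotProduct_add] }
  have hφ : ∀ x : κ → ℂ, φ (vecMulVec x (star x)) = ‖star z ⬝ᵥ x‖ ^ 2 := by
    intro x
    have h1 : star x ⬝ᵥ z = star (star z ⬝ᵥ x) := by
      rw [star_dotProduct]
    change (star z ⬝ᵥ (vecMulVec x (star x) *ᵥ z)).re = _
    rw [vecMulVec_mulVec, dotProduct_smul, h1]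
    simp [← Complex.normSq_eq_norm_sq, Complex.normSq_apply]
  have hsum := congrArg φ h
  rw [map_list_sum, List.map_map, hφ, hzu] at hsum
  have hle : ‖star z ⬝ᵥ w b‖ ^ 2 ≤ 0 := by
    have := List.single_le_sum (l := l.map (φ ∘ fun b => vecMulVec (w b) (star (w b)))) (by
      intro x hx
      obtain ⟨b', -, rfl⟩ := List.mem_map.1 hx
      simp only [Function.comp_apply, hφ]
      positivity) _ (List.mem_map_of_mem hb)
    rw [hsum, Function.comp_apply, hφ] at this
    simpa using this
  have hzw : star z ⬝ᵥ w b = 0 := by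
    have : ‖star z ⬝ᵥ w b‖ ^ 2 = 0 := le_antisymm hle (by positivity)
    simpa using this
  have hzz : star z ⬝ᵥ z = 0 := by
    nth_rewrite 2 [hz]
    rw [dotProduct_sub, dotProduct_smul, hzw, hzu]
    simp
  exact sub_eq_zero.1 (dotProduct_star_self_eq_zero.1 hzz)

end LOCC

end Battery

theorem proposition3 {n : ℕ} {d : Fin n → ℕ}
    (H : ∀ i, Matrix (Fin (d i)) (Fin (d i)) ℂ) (hH : ∀ i, (H i).IsHermitian)
    (Ψ : EuclideanSpace ℂ (∀ i, Fin (d i))) (hΨ : ‖Ψ‖ = 1)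
    (P : Battery.LOCCProtocol d d) :
    (P.krausOps.map fun M =>
        Battery.outcomeProb M (Battery.pureState Ψ) *
          Battery.capacityGap H (Battery.postState M (Battery.pureState Ψ))).sum
      ≤ Battery.capacityGap H (Battery.pureState Ψ) ∧
    ∀ Φ : EuclideanSpace ℂ (∀ i, Fin (d i)), ‖Φ‖ = 1 →
      P.channel (Battery.pureState Ψ) = Battery.pureState Φ →
      Battery.capacityGap H (Battery.pureState Φ)
        ≤ Battery.capacityGap H (Battery.pureState Ψ) := by
  have hmain := Battery.capacityGap_vecMulVec_le hH P Ψ.ofLp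
  simp only [Battery.pureState_eq_vecMulVec, Battery.outcomeProb_mul_capacityGap_postState]
  refine ⟨hmain, fun Φ hΦ hch => ?_⟩
  simp only [Battery.LOCCProtocol.channel, Battery.mul_vecMulVec_star_mul] at hch
  have hΦ' : Battery.sqNorm Φ.ofLp = 1 := by rw [Battery.sqNorm_ofLp, hΦ, one_pow]
  have hterm : ∀ M ∈ P.krausOps,
      Matrix.vecMulVec (M.mulVec Ψ.ofLp) (star (M.mulVec Ψ.ofLp)) =
        (Battery.sqNorm (M.mulVec Ψ.ofLp) : ℂ) • Matrix.vecMulVec Φ.ofLp (star Φ.ofLp) := by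
    intro M hM
    have h := Battery.eq_smul_of_sum_vecMulVec_eq hΦ' hch hM
    generalize dotProduct (star Φ.ofLp) (M.mulVec Ψ.ofLp) = c at h
    rw [← Battery.star_dotProduct_self, h]
    simp only [star_smul, smul_dotProduct, dotProduct_smul, Battery.star_dotProduct_self, hΦ',
      Matrix.smul_vecMulVec, Matrix.vecMulVec_smul, smul_smul]
    congr 1
    simp [mul_comm]
  have hsum : (P.krausOps.map fun M => Battery.sqNorm (M.mulVec Ψ.ofLp)).sum = 1 := by
    have := congrArg (fun ρ => (Matrix.trace ρ).re) hch
    simp only [Battery.trace_vecMulVec_star, hΦ', Complex.ofReal_re] at this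
    rw [← this, ← Matrix.traceAddMonoidHom_apply, ← Complex.coe_reAddGroupHom,
      map_list_sum, map_list_sum, List.map_map, List.map_map]
    simp only [Function.comp_def, Matrix.traceAddMonoidHom_apply, Battery.trace_vecMulVec_star,
      Complex.coe_reAddGroupHom, Complex.ofReal_re]
  -- Every outcome contributes its probability times the gap of `Φ`, and the probabilities sum to
  -- one.
  refine le_trans (le_of_eq ?_) hmain
  rw [List.map_congr_left fun M hM => by
    rw [hterm M hM, Battery.capacityGap_smul H _ (Battery.sqNorm_nonneg _)], List.sum_map_mul_right, hsum,
    one_mul]
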